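/- Let $f,\theta_1,\dots,\theta_s\in\mathbb R[\mathbf y]$ be polynomials in $\mathbf y=(y_1,\dots,y_\ell)$, let $G(\mathbf x)$ be a symmetric $q\times q$ polynomial matrix in $\mathbf x=(x_1,\dots,x_n)$, and let $P(\mathbf y,\mathbf x)=\sum_{\beta}P_\beta(\mathbf x)\,\mathbf y^\beta$ be a symmetric $m\times m$ polynomial matrix in $(\mathbf y,\mathbf x)$. Put $\mathcal Y=\{\mathbf y\in\mathbb R^\ell:\theta_1(\mathbf y)\ge0,\dots,\theta_s(\mathbf y)\ge0\}$ and $\mathcal X=\{\mathbf x\in\mathbb R^n: G(\mathbf x)\succeq0\}$, and let $$f^\star=\inf\{f(\mathbf y):\ \mathbf y\in\mathcal Y,\ P(\mathbf y,\mathbf x)\succeq0\ \text{ for all }\mathbf x\in\mathcal X\}.$$ A polynomial $h\in\mathbb R[\mathbf y]$ is called SOS-convex if its Hessian equals $T^{\intercal}T$ for some (rectangular) polynomial matrix $T(\mathbf y)$; a symmetric polynomial matrix $Q(\mathbf y)$ is called PSD-SOS-convex if $\mathbf v^{\intercal}Q(\mathbf y)\mathbf v$ is SOS-convex for every real vector $\mathbf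 v$. Assume that 1. $f,-\theta_1,\dots,-\theta_s$ are SOS-convex; $-P(\cdot,\mathbf x)$ is PSD-SOS-convex in $\mathbf y$ for every $\mathbf x\in\mathcal X$; and $\mathcal X$ is compact; 2. (Slater condition) there is $\bar{\mathbf y}\in\mathcal Y$ with $\theta_i(\bar{\mathbf y})>0$ for all $i$ and $P(\bar{\mathbf y},\mathbf x)\succ0$ for all $\mathbf x\in\mathcal X$. Let $\mathfrak M^m_+(\mathcal X)$ be the set of PSD matrix-valued measures on $\mathcal X$, that is, symmetric $m\times m$ arrays $\Phi=[\phi_{ij}]$ of finite signed Borel measures on $\mathcal X$ such that the matrix $[\phi_{ij}(A)]$ is positive semidefinite for every Borel set $A\subseteq\mathcal X$. For $\Phi\in\mathfrak M^m_+(\mathcal X)$ put $$\mathscr L_\Phi(F)=\sum_{i,j}\int_{\mathcal X}F_{ij}\,d\phi_{ij}\quad\text{for symmetric polynomial matrices }F(\mathbf x),\qquad \mathscr L_\Phi(P)=\sum_\beta\mathscr L_\Phi(P_\beta)\,\mathbf y^\beta\in\mathbb R[\mathbf y].$$ For a finite positive Borel measure $\mu$ on $\mathcal Y$ for which all polynomials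 are integrable put $$\mathscr H_\mu(h)=\int_{\mathcal Y}h\,d\mu\quad\text{for }h\in\mathbb R[\mathbf y],\qquad \mathscr H_\mu(P)=\sum_\beta P_\beta(\mathbf x)\,\mathscr H_\mu(\mathbf y^\beta).$$ Define, with values in $[-\infty,+\infty]$, $$\tilde f=\sup\{\rho:\ \rho\in\mathbb R,\ \Phi\in\mathfrak M^m_+(\mathcal X),\ f-\rho-\mathscr L_\Phi(P)\ge0\text{ on }\mathcal Y\},$$ $$\hat f=\inf\{\mathscr H_\mu(f):\ \mu\text{ as above},\ \mathscr H_\mu(1)=1,\ \mathscr H_\mu(P)(\mathbf x)\succeq0\text{ for all }\mathbf x\in\mathcal X\}.$$ Then $$\tilde f=\hat f=f^\star .$$ -/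

import Mathlib

open MvPolynomial MeasureTheory

noncomputable section

namespace RobustPMI

/-! ### Polynomial matrices and SOS-convexity -/

/-- `m × m` polynomial matrices with real coefficients in the variables indexed by `σ`. -/
abbrev PolyMatrix (m : ℕ) (σ : Type) : Type :=
  Matrix (Fin m) (Fin m) (MvPolynomial σ ℝ)

/-- An SOS matrix: `S = Tᵀ T` for some `l × q` polynomial matrix `T`, `l ∈ ℕ`. -/
def IsSOSMatrix {q : ℕ} {σ : Type} (S : PolyMatrix q σ) : Prop :=
  ∃ (l : ℕ) (T : Matrix (Fin l) (Fin q) (MvPolynomial σ ℝ)), S = T.transpose * T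

/-- The Hessian matrix of a polynomial. -/
def hessian {ℓ : ℕ} (h : MvPolynomial (Fin ℓ) ℝ) : PolyMatrix ℓ (Fin ℓ) :=
  Matrix.of fun i j => pderiv i (pderiv j h)

/-- A polynomial is SOS-convex if its Hessian is an SOS matrix. -/
def SOSConvex {ℓ : ℕ} (h : MvPolynomial (Fin ℓ) ℝ) : Prop :=
  IsSOSMatrix (hessian h)

/-- The polynomial `vᵀ Q v` for a real vector `v`. -/
def quadForm {m : ℕ} {σ : Type} (Q : PolyMatrix m σ) (v : Fin m → ℝ) : MvPolynomial σ ℝ :=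
  ∑ i, ∑ j, C (v i) * Q i j * C (v j)

/-- A polynomial matrix `Q` is PSD-SOS-convex if for every real vector `v` the Hessian of
`vᵀ Q v` is of the form `Fᵀ F` for a polynomial matrix `F`. -/
def PSDSOSConvex {m ℓ : ℕ} (Q : PolyMatrix m (Fin ℓ)) : Prop :=
  ∀ v : Fin m → ℝ, IsSOSMatrix (hessian (quadForm Q v))

/-- The value of a polynomial matrix at a point. -/
def evalMatrix {m : ℕ} {σ : Type} (F : PolyMatrix m σ) (x : σ → ℝ) :
    Matrix (Fin m) (Fin m) ℝ :=
  F.map (eval x)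

/-! ### The robust problem

The matrix `P(y, x)` has entries in `ℝ[y, x]`; the variables `y` are indexed by the left summand
of `Fin ℓ ⊕ Fin n` and the variables `x` by the right one. -/

/-- The set `{x ∈ ℝⁿ | G(x) ⪰ 0}`. -/
def uncertaintySet {n q : ℕ} (G : PolyMatrix q (Fin n)) : Set (Fin n → ℝ) :=
  {x | (evalMatrix G x).PosSemidef}

/-- The set `{y ∈ ℝ^ℓ | θ₁(y) ≥ 0, …, θ_s(y) ≥ 0}`. -/
def decisionSet {ℓ s : ℕ} (θ : Fin s → MvPolynomial (Fin ℓ) ℝ) : Set (Fin ℓ → ℝ) :=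
  {y | ∀ i, 0 ≤ eval y (θ i)}

/-- The real matrix `P(y, x)`. -/
def evalP {ℓ n m : ℕ} (P : PolyMatrix m (Fin ℓ ⊕ Fin n)) (y : Fin ℓ → ℝ) (x : Fin n → ℝ) :
    Matrix (Fin m) (Fin m) ℝ :=
  evalMatrix P (Sum.elim y x)

/-- The polynomial matrix `P(·, x)` in the variables `y`, for a fixed point `x`. -/
def specialize {ℓ n m : ℕ} (P : PolyMatrix m (Fin ℓ ⊕ Fin n)) (x : Fin n → ℝ) :
    PolyMatrix m (Fin ℓ) :=
  P.map (aeval (Sum.elim X (fun j => C (x j))))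

/-- The optimal value of: minimize `f(y)` over `y ∈ Y` subject to `P(y, x) ⪰ 0` for all `x ∈ 𝒳`. -/
def optVal {ℓ n m : ℕ} (f : MvPolynomial (Fin ℓ) ℝ) (P : PolyMatrix m (Fin ℓ ⊕ Fin n))
    (Y : Set (Fin ℓ → ℝ)) (𝒳 : Set (Fin n → ℝ)) : EReal :=
  sInf {r : EReal | ∃ y ∈ Y, (∀ x ∈ 𝒳, (evalP P y x).PosSemidef) ∧ r = ((eval y f : ℝ) : EReal)}

/-- The Slater condition. -/
def Slater {ℓ n m s : ℕ} (θ : Fin s → MvPolynomial (Fin ℓ) ℝ)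
    (P : PolyMatrix m (Fin ℓ ⊕ Fin n)) (𝒳 : Set (Fin n → ℝ)) : Prop :=
  ∃ y : Fin ℓ → ℝ, (∀ i, 0 < eval y (θ i)) ∧ ∀ x ∈ 𝒳, (evalP P y x).PosDef

/-! ### Coefficients with respect to `y`, and functionals applied to `P(y, x)` -/

/-- The coefficient matrix `P_β(x)` of `y^β` in `P(y, x) = ∑_β P_β(x) y^β`. -/
def coeffY {ℓ n m : ℕ} (P : PolyMatrix m (Fin ℓ ⊕ Fin n)) (β : Fin ℓ →₀ ℕ) :
    PolyMatrix m (Fin n) :=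
  P.map fun p => coeff β (sumAlgEquiv ℝ (Fin ℓ) (Fin n) p)

/-- The finite set of exponents `β` such that `y^β` occurs in some entry of `P(y, x)`. -/
def supportY {ℓ n m : ℕ} (P : PolyMatrix m (Fin ℓ ⊕ Fin n)) : Finset (Fin ℓ →₀ ℕ) :=
  Finset.univ.biUnion fun i => Finset.univ.biUnion fun j =>
    (sumAlgEquiv ℝ (Fin ℓ) (Fin n) (P i j)).support

/-- `ℒ(P(y, x)) = ∑_β ℒ(P_β(x)) y^β ∈ ℝ[y]`. -/
def applyL {ℓ n m : ℕ} (L : PolyMatrix m (Fin n) → ℝ) (P : PolyMatrix m (Fin ℓ ⊕ Fin n)) :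
    MvPolynomial (Fin ℓ) ℝ :=
  ∑ β ∈ supportY P, monomial β (L (coeffY P β))

/-- `ℋ(P(y, x)) = ∑_β ℋ(y^β) P_β(x)`, a polynomial matrix in `x`. -/
def applyH {ℓ n m : ℕ} (H : MvPolynomial (Fin ℓ) ℝ → ℝ) (P : PolyMatrix m (Fin ℓ ⊕ Fin n)) :
    PolyMatrix m (Fin n) :=
  ∑ β ∈ supportY P, H (monomial β 1) • coeffY P β

/-! ### The cones of nonnegative polynomials and of PSD matrix-valued measures -/

/-- Polynomials that are nonnegative on `Y`. -/
def nonnegOn {ℓ : ℕ} (Y : Set (Fin ℓ → ℝ)) : Set (MvPolynomial (Fin ℓ) ℝ) :=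
  {h | ∀ y ∈ Y, 0 ≤ eval y h}

/-- Symmetric polynomial matrices that are PSD at every point of `𝒳`. -/
def psdOn {n : ℕ} (m : ℕ) (𝒳 : Set (Fin n → ℝ)) : Set (PolyMatrix m (Fin n)) :=
  {F | F.IsSymm ∧ ∀ x ∈ 𝒳, (evalMatrix F x).PosSemidef}

/-- PSD symmetric matrix-valued measures on `𝒳`: symmetric `m × m` arrays of finite signed Borel
measures `φ i j` on `𝒳` such that `[φ i j (A)]` is PSD for every Borel set `A ⊆ 𝒳`. -/
structure PSDMatrixMeasure (m : ℕ) {n : ℕ} (𝒳 : Set (Fin n → ℝ)) where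
  /-- the entries -/
  φ : Fin m → Fin m → SignedMeasure 𝒳
  symm : ∀ i j, φ i j = φ j i
  psd : ∀ A : Set 𝒳, MeasurableSet A → (Matrix.of fun i j => φ i j A).PosSemidef

/-- `ℒ_Φ(F) = ∑_{i,j} ∫_𝒳 F_{ij} dφ_{ij}`. -/
def momentL {m n : ℕ} {𝒳 : Set (Fin n → ℝ)} (Φ : PSDMatrixMeasure m 𝒳)
    (F : PolyMatrix m (Fin n)) : ℝ :=
  ∑ i, ∑ j, (Φ.φ i j).integral (fun x : 𝒳 => eval (x : Fin n → ℝ) (F i j))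
    (ContinuousLinearMap.lsmul ℝ ℝ)

/-- `ℋ_μ(h) = ∫_Y h dμ`. -/
def momentH {ℓ : ℕ} {Y : Set (Fin ℓ → ℝ)} (μ : Measure Y) (h : MvPolynomial (Fin ℓ) ℝ) : ℝ :=
  ∫ y : Y, eval (y : Fin ℓ → ℝ) h ∂μ

/-! ### The conic reformulation and its dual -/

/-- `sup ρ` over `ρ ∈ ℝ` and PSD matrix-valued measures `Φ` on `𝒳` such that
`f − ρ − ℒ_Φ(P)` is nonnegative on `Y`. -/
def conicVal {ℓ n m : ℕ} (f : MvPolynomial (Fin ℓ) ℝ) (P : PolyMatrix m (Fin ℓ ⊕ Fin n))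
    (Y : Set (Fin ℓ → ℝ)) (𝒳 : Set (Fin n → ℝ)) : EReal :=
  sSup {r : EReal | ∃ (ρ : ℝ) (Φ : PSDMatrixMeasure m 𝒳),
    f - C ρ - applyL (momentL Φ) P ∈ nonnegOn Y ∧ r = (ρ : EReal)}

/-- `inf ℋ_μ(f)` over finite Borel measures `μ` on `Y` with `ℋ_μ(1) = 1` and `ℋ_μ(P)` PSD on `𝒳`.
That the functional `ℋ_μ` is defined on `ℝ[y]` means that all polynomials are `μ`-integrable. -/
def dualVal {ℓ n m : ℕ} (f : MvPolynomial (Fin ℓ) ℝ) (P : PolyMatrix m (Fin ℓ ⊕ Fin n))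
    (Y : Set (Fin ℓ → ℝ)) (𝒳 : Set (Fin n → ℝ)) : EReal :=
  sInf {r : EReal | ∃ μ : Measure Y, IsFiniteMeasure μ ∧
    (∀ h : MvPolynomial (Fin ℓ) ℝ, Integrable (fun y : Y => eval (y : Fin ℓ → ℝ) h) μ) ∧
    momentH μ 1 = 1 ∧ applyH (momentH μ) P ∈ psdOn m 𝒳 ∧ r = ((momentH μ f : ℝ) : EReal)}

end RobustPMI

end

/-! The proof closes the cycle `conicVal` ≤ `dualVal` ≤ `optVal` ≤ `conicVal`. Weak duality
(`conicVal_le_dualVal`) integrates the certificate f − ρ − ℒ_Φ(P) ≥ 0 against μ and uses ℒ_Φ(F) ≥ 0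
for F PSD on the compact 𝒳. Dirac measures at feasible points give the second inequality.

The third inequality carries the content (`exists_multiplier`). SOS-convexity enters only through
ordinary convexity. Slater's condition yields exact penalization (`exists_penalty`): at each y,
violating the constraint can be charged to one rank-one multiplier v vᵀ δ_x, with ‖v‖ bounded
independently of y. A multiplier matters only through its finite vector (ℒ(P_β))_β, so these choices
lie in a compact convex subset of a finite-dimensional space, and Sion's minimax argument replaces
the multipliers depending on y by a single one. The convex hull consists of vectors of genuine PSD
matrix measures, so the value is attained by some Φ. -/

noncomputable section

namespace RobustPMI

/-! ### Integration against PSD matrix-valued measures -/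

-- Factoring B = DᵀD turns the sum into the values of the quadratic form of A at the rows of D.
open scoped MatrixOrder in
theorem _root_.Matrix.PosSemidef.sum_mul_nonneg {m : ℕ} {A B : Matrix (Fin m) (Fin m) ℝ}
    (hA : A.PosSemidef) (hB : B.PosSemidef) : 0 ≤ ∑ i, ∑ j, A i j * B i j := by
  obtain ⟨D, hD⟩ := CStarAlgebra.nonneg_iff_eq_star_mul_self.mp hB.nonneg
  have hB' : ∀ i j, B i j = ∑ k, D k i * D k j := fun i j => by
    rw [hD, Matrix.mul_apply]; rfl
  have hsum : ∑ i, ∑ j, A i j * B i j = ∑ k, D k ⬝ᵥ A.mulVec (D k) := by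
    simp_rw [hB', dotProduct, Matrix.mulVec, dotProduct, Finset.mul_sum]
    rw [Finset.sum_comm' (t' := Finset.univ) (s' := fun _ => Finset.univ) (by simp)]
    conv_rhs => rw [Finset.sum_comm]
    rw [Finset.sum_comm]
    refine Finset.sum_congr rfl fun i _ => ?_
    rw [Finset.sum_comm]
    exact Finset.sum_congr rfl fun k _ => Finset.sum_congr rfl fun j _ => by ring
  rw [hsum]
  exact Finset.sum_nonneg fun k _ => by simpa using hA.dotProduct_mulVec_nonneg (D k)

instance _root_.MeasureTheory.SignedMeasure.isFiniteMeasure_variation {α : Type*}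
    [MeasurableSpace α] (φ : SignedMeasure α) : IsFiniteMeasure φ.variation := by
  rw [← SignedMeasure.totalVariation_eq_variation]; infer_instance

/-- The integral of a matrix-valued function against a matrix of signed measures. -/
def pairing {α : Type*} [MeasurableSpace α] {m : ℕ} (φ : Fin m → Fin m → SignedMeasure α)
    (g : α → Fin m → Fin m → ℝ) : ℝ :=
  ∑ i, ∑ j, (φ i j).integral (fun x => g x i j) (ContinuousLinearMap.lsmul ℝ ℝ)

theorem integral_simpleFunc_apply {α : Type*} [MeasurableSpace α] {m : ℕ} (φ : SignedMeasure α)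
    (g : SimpleFunc α (Fin m → Fin m → ℝ)) (i j : Fin m) :
    φ.integral (fun x => g x i j) (ContinuousLinearMap.lsmul ℝ ℝ) =
      ∑ a ∈ g.range, a i j * φ (g ⁻¹' {a}) := by
  have hg : (fun x => g x i j) =
      fun x => ∑ a ∈ g.range, (g ⁻¹' {a}).indicator (fun _ => a i j) x := by
    funext x
    rw [Finset.sum_eq_single (g x)]
    · simp
    · intro b _ hb
      exact Set.indicator_of_notMem (fun h => hb (by simpa using h.symm)) _
    · intro h
      exact absurd (SimpleFunc.mem_range_self g x) h
  rw [hg, VectorMeasure.integral_finsetSum]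
  · refine Finset.sum_congr rfl fun a _ => ?_
    rw [VectorMeasure.integral_eq_setToFun, setToFun_indicator_const _ (g.measurableSet_fiber a)
      (measure_ne_top _ _)]
    rfl
  · intro a _
    exact (integrable_const _).indicator (g.measurableSet_fiber a)

theorem pairing_simpleFunc_nonneg {α : Type*} [MeasurableSpace α] {m : ℕ}
    {φ : Fin m → Fin m → SignedMeasure α}
    (hφ : ∀ A, MeasurableSet A → (Matrix.of fun i j => φ i j A).PosSemidef)
    (g : SimpleFunc α (Fin m → Fin m → ℝ)) (hg : ∀ x, (Matrix.of (g x)).PosSemidef) :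
    0 ≤ pairing φ g := by
  have h : pairing φ g = ∑ a ∈ g.range, ∑ i, ∑ j, a i j * φ i j (g ⁻¹' {a}) := by
    simp_rw [pairing, integral_simpleFunc_apply]
    exact (Finset.sum_congr rfl fun i _ => Finset.sum_comm).trans Finset.sum_comm
  rw [h]
  refine Finset.sum_nonneg fun a ha => ?_
  obtain ⟨x, rfl⟩ := SimpleFunc.mem_range.mp ha
  exact (hg x).sum_mul_nonneg (hφ _ (g.measurableSet_fiber _))

/-- Approximating by simple functions with values in the PSD cone itself keeps every approximant
within reach of `pairing_simpleFunc_nonneg`; dominated convergence does the rest. -/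
theorem pairing_nonneg {α : Type*} [MeasurableSpace α] {m : ℕ}
    {φ : Fin m → Fin m → SignedMeasure α}
    (hφ : ∀ A, MeasurableSet A → (Matrix.of fun i j => φ i j A).PosSemidef)
    {g : α → Fin m → Fin m → ℝ} (hgm : Measurable g) {M : ℝ} (hM : ∀ x, ‖g x‖ ≤ M)
    (hg : ∀ x, (Matrix.of (g x)).PosSemidef) :
    0 ≤ pairing φ g := by
  set s : Set (Fin m → Fin m → ℝ) := {A | (Matrix.of A).PosSemidef}
  have h0 : (0 : Fin m → Fin m → ℝ) ∈ s := Matrix.PosSemidef.zero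
  refine ge_of_tendsto' (f := fun n => pairing φ (SimpleFunc.approxOn g hgm s 0 h0 n))
    (x := Filter.atTop) ?_
    fun n => pairing_simpleFunc_nonneg hφ _ fun x => SimpleFunc.approxOn_mem hgm h0 n x
  refine tendsto_finsetSum _ fun i _ => tendsto_finsetSum _ fun j _ => ?_
  -- The approximants based at 0 satisfy only ‖gₙ x‖ ≤ ‖g x‖ + ‖g x‖, hence the bound `M + M`.
  refine VectorMeasure.tendsto_integral_of_dominated_convergence (fun _ => M + M) ?_
    (integrable_const _) ?_ ?_
  · intro n
    have h := (SimpleFunc.approxOn g hgm s 0 h0 n).measurable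
    exact (measurable_pi_iff.mp (measurable_pi_iff.mp h i) j).aestronglyMeasurable
  · intro n
    refine Filter.Eventually.of_forall fun x => ?_
    have h1 := SimpleFunc.norm_approxOn_zero_le hgm h0 x n
    have h2 := norm_le_pi_norm (SimpleFunc.approxOn g hgm s 0 h0 n x) i
    have h3 := norm_le_pi_norm (SimpleFunc.approxOn g hgm s 0 h0 n x i) j
    linarith [hM x]
  · refine Filter.Eventually.of_forall fun x => ?_
    have h := SimpleFunc.tendsto_approxOn hgm h0 (subset_closure (hg x))
    exact ((tendsto_pi_nhds.mp ((tendsto_pi_nhds.mp h) i)) j)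

section Moments

variable {m n : ℕ} {𝒳 : Set (Fin n → ℝ)}

theorem continuous_eval_coe (p : MvPolynomial (Fin n) ℝ) :
    Continuous fun x : 𝒳 => eval (x : Fin n → ℝ) p :=
  (MvPolynomial.continuous_eval p).comp continuous_subtype_val

theorem integrable_eval (h𝒳 : IsCompact 𝒳) (φ : SignedMeasure 𝒳) (p : MvPolynomial (Fin n) ℝ) :
    φ.Integrable fun x : 𝒳 => eval (x : Fin n → ℝ) p := by
  have : CompactSpace 𝒳 := isCompact_iff_compactSpace.mp h𝒳
  exact (continuous_eval_coe p).integrable_of_hasCompactSupport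
    (HasCompactSupport.of_compactSpace _)

theorem momentL_nonneg (h𝒳 : IsCompact 𝒳) (Φ : PSDMatrixMeasure m 𝒳) {F : PolyMatrix m (Fin n)}
    (hF : ∀ x ∈ 𝒳, (evalMatrix F x).PosSemidef) : 0 ≤ momentL Φ F := by
  have : CompactSpace 𝒳 := isCompact_iff_compactSpace.mp h𝒳
  have hc : Continuous fun (x : 𝒳) (i j : Fin m) => eval (x : Fin n → ℝ) (F i j) :=
    continuous_pi fun i => continuous_pi fun j => continuous_eval_coe _
  obtain ⟨M, hM⟩ := isCompact_univ.exists_bound_of_continuousOn hc.continuousOn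
  exact pairing_nonneg Φ.psd hc.measurable (fun x => hM x trivial) fun x => hF x x.2

theorem momentL_sum_smul (h𝒳 : IsCompact 𝒳) (Φ : PSDMatrixMeasure m 𝒳) {ι : Type*} (s : Finset ι)
    (c : ι → ℝ) (F : ι → PolyMatrix m (Fin n)) :
    momentL Φ (∑ k ∈ s, c k • F k) = ∑ k ∈ s, c k * momentL Φ (F k) := by
  simp_rw [momentL, Finset.mul_sum]
  refine Eq.trans ?_ (Finset.sum_comm.trans (Finset.sum_congr rfl fun i _ =>
    Finset.sum_comm)).symm
  refine Finset.sum_congr rfl fun i _ => Finset.sum_congr rfl fun j _ => ?_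
  have h : (fun x : 𝒳 => eval (x : Fin n → ℝ) ((∑ k ∈ s, c k • F k) i j)) =
      fun x : 𝒳 => ∑ k ∈ s, c k • eval (x : Fin n → ℝ) (F k i j) := by
    funext x
    simp [Matrix.sum_apply, smul_eval]
  rw [h]
  refine (VectorMeasure.integral_finsetSum (f := fun k (x : 𝒳) => c k • eval (x : Fin n → ℝ) (F k i j))
    s
    fun k _ => (integrable_eval h𝒳 _ _).smul (c k)).trans ?_
  exact Finset.sum_congr rfl fun k _ => VectorMeasure.integral_fun_smul _ _ _ _

/-- A nonnegative combination of PSD matrix-valued measures. -/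
def PSDMatrixMeasure.combo (Φ Ψ : PSDMatrixMeasure m 𝒳) {a b : ℝ} (ha : 0 ≤ a) (hb : 0 ≤ b) :
    PSDMatrixMeasure m 𝒳 where
  φ i j := a • Φ.φ i j + b • Ψ.φ i j
  symm i j := by rw [Φ.symm, Ψ.symm]
  psd A hA := ((Φ.psd A hA).smul ha).add ((Ψ.psd A hA).smul hb)

theorem momentL_combo (h𝒳 : IsCompact 𝒳) (Φ Ψ : PSDMatrixMeasure m 𝒳) {a b : ℝ} (ha : 0 ≤ a)
    (hb : 0 ≤ b) (F : PolyMatrix m (Fin n)) :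
    momentL (Φ.combo Ψ ha hb) F = a * momentL Φ F + b * momentL Ψ F := by
  simp_rw [momentL, PSDMatrixMeasure.combo, Finset.mul_sum, ← Finset.sum_add_distrib]
  refine Finset.sum_congr rfl fun i _ => Finset.sum_congr rfl fun j _ => ?_
  rw [VectorMeasure.integral_add_vectorMeasure
    ((integrable_eval h𝒳 _ _).smul_vectorMeasure a) ((integrable_eval h𝒳 _ _).smul_vectorMeasure b)]
  simp

/-- The matrix-valued measure `v vᵀ δ_x`. -/
def PSDMatrixMeasure.dirac (x : 𝒳) (v : Fin m → ℝ) : PSDMatrixMeasure m 𝒳 where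
  φ i j := VectorMeasure.dirac x (v i * v j)
  symm i j := by rw [mul_comm]
  psd A hA := by
    by_cases hx : x ∈ A
    · have h : (Matrix.of fun i j => (VectorMeasure.dirac x (v i * v j)) A) =
          Matrix.vecMulVec v (star v) := by
        ext i j
        simp [hA, hx, Matrix.vecMulVec]
      rw [h]
      exact Matrix.posSemidef_vecMulVec_self_star v
    · have h : (Matrix.of fun i j => (VectorMeasure.dirac x (v i * v j)) A) = 0 := by
        ext i j
        simp [hx]
      rw [h]
      exact Matrix.PosSemidef.zero

theorem momentL_dirac (x : 𝒳) (v : Fin m → ℝ) (F : PolyMatrix m (Fin n)) :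
    momentL (PSDMatrixMeasure.dirac x v) F = v ⬝ᵥ (evalMatrix F x).mulVec v := by
  simp_rw [momentL, PSDMatrixMeasure.dirac, VectorMeasure.integral_dirac, dotProduct,
    Matrix.mulVec, dotProduct, Finset.mul_sum]
  refine Finset.sum_congr rfl fun i _ => Finset.sum_congr rfl fun j _ => ?_
  simp [evalMatrix]
  ring

end Moments

/-! ### Convexity of SOS-convex polynomials -/

/-- The restriction of a polynomial to the line `t ↦ y + t d`. -/
def restrictLine {ℓ : ℕ} (y d : Fin ℓ → ℝ) : MvPolynomial (Fin ℓ) ℝ →ₐ[ℝ] Polynomial ℝ :=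
  aeval fun i => Polynomial.C (y i) + Polynomial.C (d i) * Polynomial.X

theorem eval_restrictLine {ℓ : ℕ} (y d : Fin ℓ → ℝ) (t : ℝ) (p : MvPolynomial (Fin ℓ) ℝ) :
    (restrictLine y d p).eval t = eval (y + t • d) p := by
  induction p using MvPolynomial.induction_on with
  | C a => simp [restrictLine]
  | add p q hp hq => simp [hp, hq]
  | mul_X p i hp =>
    rw [map_mul, Polynomial.eval_mul, hp, eval_mul]
    simp [restrictLine, mul_comm t]

theorem derivative_restrictLine {ℓ : ℕ} (y d : Fin ℓ → ℝ) (p : MvPolynomial (Fin ℓ) ℝ) :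
    Polynomial.derivative (restrictLine y d p) =
      ∑ i, Polynomial.C (d i) * restrictLine y d (pderiv i p) := by
  induction p using MvPolynomial.induction_on with
  | C a => simp [restrictLine]
  | add p q hp hq => simp [hp, hq, mul_add, Finset.sum_add_distrib]
  | mul_X p j hp =>
    have h : ∀ i, Polynomial.C (d i) * restrictLine y d (pderiv i (p * X j)) =
        Polynomial.C (d i) * restrictLine y d (pderiv i p) * restrictLine y d (X j) +
          if i = j then restrictLine y d p * Polynomial.C (d i) else 0 := by
      intro i
      split_ifs with hij
      · subst hij
        simp; ring
      · simp [pderiv_X_of_ne (Ne.symm hij)]; ring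
    simp_rw [h, Finset.sum_add_distrib, ← Finset.sum_mul, ← hp, map_mul,
      Polynomial.derivative_mul]
    simp [restrictLine]

/-- The sum is ‖T d‖² for S = TᵀT. Its nesting and index order match the second derivative along a
line produced by applying `derivative_restrictLine` twice. -/
theorem IsSOSMatrix.sum_mul_eval_nonneg {q : ℕ} {σ : Type} {S : PolyMatrix q σ}
    (hS : IsSOSMatrix S) (d : Fin q → ℝ) (p : σ → ℝ) :
    0 ≤ ∑ i, d i * ∑ j, d j * eval p (S j i) := by
  obtain ⟨l, T, rfl⟩ := hS
  have h : ∑ i, d i * ∑ j, d j * eval p ((T.transpose * T) j i) =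
      ∑ k, (∑ i, d i * eval p (T k i)) ^ 2 := by
    simp_rw [sq, Finset.sum_mul_sum, Matrix.mul_apply, Matrix.transpose_apply, map_sum,
      Finset.mul_sum, map_mul]
    refine (Finset.sum_congr rfl fun i _ => Finset.sum_comm).trans
      (Finset.sum_comm.trans (Finset.sum_congr rfl fun k _ => ?_))
    exact Finset.sum_congr rfl fun i _ => Finset.sum_congr rfl fun j _ => by ring
  rw [h]
  positivity

theorem SOSConvex.convexOn {ℓ : ℕ} {p : MvPolynomial (Fin ℓ) ℝ} (hp : SOSConvex p) :
    ConvexOn ℝ Set.univ fun y => eval y p := by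
  have hline : ∀ y d : Fin ℓ → ℝ, ConvexOn ℝ Set.univ fun t => (restrictLine y d p).eval t := by
    intro y d
    have hder : ∀ r : Polynomial ℝ, deriv (fun t => r.eval t) = fun t => r.derivative.eval t :=
      fun r => funext fun t => r.deriv
    refine convexOn_of_deriv2_nonneg' convex_univ (Polynomial.differentiable _).differentiableOn
      ?_ fun t _ => ?_
    · rw [hder]
      exact (Polynomial.differentiable _).differentiableOn
    · have h := IsSOSMatrix.sum_mul_eval_nonneg hp d (y + t • d)
      rw [Function.iterate_succ, Function.iterate_one, Function.comp_apply, hder, hder,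
        derivative_restrictLine, Polynomial.derivative_sum]
      simp_rw [Polynomial.eval_finsetSum, Polynomial.derivative_C_mul, derivative_restrictLine, Polynomial.eval_C_mul,
        Polynomial.eval_finsetSum, Polynomial.eval_C_mul, eval_restrictLine]
      exact h
  refine ⟨convex_univ, fun y _ z _ a b ha hb hab => ?_⟩
  have h := (hline y (z - y)).2 (Set.mem_univ 0) (Set.mem_univ 1) ha hb hab
  simp only [eval_restrictLine, smul_eq_mul, mul_zero, zero_add, mul_one, zero_smul, add_zero,
    one_smul, add_sub_cancel] at h
  have e : a • y + b • z = y + b • (z - y) := by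
    rw [← eq_sub_iff_add_eq] at hab
    subst hab
    module
  rw [e]
  exact h

theorem SOSConvex.concaveOn_of_neg {ℓ : ℕ} {p : MvPolynomial (Fin ℓ) ℝ} (hp : SOSConvex (-p)) :
    ConcaveOn ℝ Set.univ fun y => eval y p := by
  have h : (fun y => eval y p) = -fun y => eval y (-p) := by
    funext y
    simp
  rw [h]
  exact hp.convexOn.neg

theorem convex_decisionSet {ℓ s : ℕ} {θ : Fin s → MvPolynomial (Fin ℓ) ℝ}
    (hθ : ∀ i, SOSConvex (-θ i)) : Convex ℝ (decisionSet θ) := by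
  have h : decisionSet θ = ⋂ i, {y | y ∈ Set.univ ∧ 0 ≤ eval y (θ i)} := by
    ext y; simp [decisionSet]
  rw [h]
  exact convex_iInter fun i => (hθ i).concaveOn_of_neg.convex_ge 0

/-! ### Evaluation of `P(y, x)` -/

section Evaluation

variable {ℓ n m : ℕ}

theorem eval_aeval_sumElim (y : Fin ℓ → ℝ) (x : Fin n → ℝ) (p : MvPolynomial (Fin ℓ ⊕ Fin n) ℝ) :
    eval y (aeval (Sum.elim X fun j => C (x j)) p) = eval (Sum.elim y x) p := by
  induction p using MvPolynomial.induction_on with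
  | C a => simp
  | add p q hp hq => rw [map_add, map_add, hp, hq, map_add]
  | mul_X p i hp => rw [map_mul, map_mul, hp, map_mul]; cases i <;> simp

theorem eval₂_sumAlgEquiv (y : Fin ℓ → ℝ) (x : Fin n → ℝ) (p : MvPolynomial (Fin ℓ ⊕ Fin n) ℝ) :
    eval₂ (eval x) y (sumAlgEquiv ℝ (Fin ℓ) (Fin n) p) = eval (Sum.elim y x) p := by
  induction p using MvPolynomial.induction_on with
  | C a => simp
  | add p q hp hq => simp [hp, hq]
  | mul_X p i hp => cases i <;> simp [hp]

/-- The value of the quadratic form of `P(y, x)` at `v`. -/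
def formP (P : PolyMatrix m (Fin ℓ ⊕ Fin n)) (x : Fin n → ℝ) (v : Fin m → ℝ) (y : Fin ℓ → ℝ) : ℝ :=
  v ⬝ᵥ (evalP P y x).mulVec v

theorem concaveOn_formP {P : PolyMatrix m (Fin ℓ ⊕ Fin n)} {x : Fin n → ℝ}
    (h : PSDSOSConvex (-specialize P x)) (v : Fin m → ℝ) :
    ConcaveOn ℝ Set.univ (formP P x v) := by
  have h1 := (SOSConvex.convexOn (h v)).neg
  have e : formP P x v = -fun y => eval y (quadForm (-specialize P x) v) := by
    funext y
    simp only [formP, evalP, evalMatrix, dotProduct, Matrix.mulVec, quadForm, specialize,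
      Pi.neg_apply, Matrix.neg_apply, Matrix.map_apply, map_sum, map_mul, map_neg, eval_C,
      eval_aeval_sumElim, ← Finset.sum_neg_distrib, Finset.mul_sum]
    exact Finset.sum_congr rfl fun i _ => Finset.sum_congr rfl fun j _ => by ring
  rw [e]
  exact h1

theorem evalP_eq_sum (P : PolyMatrix m (Fin ℓ ⊕ Fin n)) (y : Fin ℓ → ℝ) (x : Fin n → ℝ) :
    evalP P y x =
      ∑ β ∈ supportY P, eval y (monomial β (1 : ℝ)) • evalMatrix (coeffY P β) x := by
  ext i j
  -- Each entry has its own support; summing over the common one adds only zero terms.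
  have hsub : (sumAlgEquiv ℝ (Fin ℓ) (Fin n) (P i j)).support ⊆ supportY P := by
    intro β hβ
    simp only [supportY, Finset.mem_biUnion, Finset.mem_univ, true_and]
    exact ⟨i, j, hβ⟩
  rw [Matrix.sum_apply, evalP, evalMatrix, Matrix.map_apply, ← eval₂_sumAlgEquiv, eval₂_eq',
    Finset.sum_subset hsub]
  · refine Finset.sum_congr rfl fun β _ => ?_
    simp [evalMatrix, coeffY, eval_monomial, Finsupp.prod_fintype, mul_comm]
  · intro β _ hβ
    simp [notMem_support_iff.mp hβ]

theorem formP_eq_sum (P : PolyMatrix m (Fin ℓ ⊕ Fin n)) (x : Fin n → ℝ) (v : Fin m → ℝ)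
    (y : Fin ℓ → ℝ) :
    formP P x v y = ∑ β ∈ supportY P,
      (v ⬝ᵥ (evalMatrix (coeffY P β) x).mulVec v) * eval y (monomial β (1 : ℝ)) := by
  rw [formP, evalP_eq_sum, Matrix.sum_mulVec, dotProduct_sum]
  exact Finset.sum_congr rfl fun β _ => by
    rw [Matrix.smul_mulVec, dotProduct_smul, smul_eq_mul, mul_comm]

theorem eval_applyL (L : PolyMatrix m (Fin n) → ℝ) (P : PolyMatrix m (Fin ℓ ⊕ Fin n))
    (y : Fin ℓ → ℝ) :
    eval y (applyL L P) = ∑ β ∈ supportY P, L (coeffY P β) * eval y (monomial β (1 : ℝ)) := by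
  simp [applyL, eval_monomial]

theorem evalMatrix_applyH (H : MvPolynomial (Fin ℓ) ℝ → ℝ) (P : PolyMatrix m (Fin ℓ ⊕ Fin n))
    (x : Fin n → ℝ) :
    evalMatrix (applyH H P) x =
      ∑ β ∈ supportY P, H (monomial β 1) • evalMatrix (coeffY P β) x := by
  ext i j
  simp [evalMatrix, applyH, Matrix.sum_apply, smul_eval]

theorem isSymm_applyH (H : MvPolynomial (Fin ℓ) ℝ → ℝ) {P : PolyMatrix m (Fin ℓ ⊕ Fin n)}
    (hP : P.IsSymm) : (applyH H P).IsSymm := by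
  ext i j
  simp [applyH, Matrix.sum_apply, coeffY, hP.apply]

theorem isSymm_evalP {P : PolyMatrix m (Fin ℓ ⊕ Fin n)} (hP : P.IsSymm) (y : Fin ℓ → ℝ)
    (x : Fin n → ℝ) : (evalP P y x).IsHermitian := by
  ext i j
  simp [evalP, evalMatrix, hP.apply]

theorem continuous_formP (P : PolyMatrix m (Fin ℓ ⊕ Fin n)) (y : Fin ℓ → ℝ) :
    Continuous fun z : (Fin n → ℝ) × (Fin m → ℝ) => formP P z.1 z.2 y := by
  simp only [formP, dotProduct, Matrix.mulVec, evalP, evalMatrix, Matrix.map_apply]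
  have h : ∀ i j, Continuous fun z : (Fin n → ℝ) × (Fin m → ℝ) =>
      eval (Sum.elim y z.1) (P i j) := fun i j =>
    (MvPolynomial.continuous_eval (P i j)).comp (continuous_pi fun k => by
      cases k <;> simp <;> fun_prop)
  fun_prop

end Evaluation

/-! ### Convex hulls of compact sets and a minimax principle -/

/-- By Carathéodory at most dim E + 1 points suffice, so the hull is a finite union of continuous
images of compact sets Δ × Sᵏ. The index k < dim E + 2 includes k = dim E + 1. -/
theorem _root_.IsCompact.convexHull_of_finiteDimensional {E : Type*} [NormedAddCommGroup E]
    [NormedSpace ℝ E] [FiniteDimensional ℝ E] {S : Set E} (hS : IsCompact S) :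
    IsCompact (convexHull ℝ S) := by
  have h : convexHull ℝ S = ⋃ k : Fin (Module.finrank ℝ E + 2),
      (fun p : (Fin k → ℝ) × (Fin k → E) => ∑ i, p.1 i • p.2 i) ''
        (stdSimplex ℝ (Fin k) ×ˢ Set.univ.pi fun _ => S) := by
    ext x
    simp only [Set.mem_iUnion, Set.mem_image, Set.mem_prod, Prod.exists]
    constructor
    · intro hx
      obtain ⟨ι, _, z, w, hz, hind, hw, hw1, rfl⟩ := eq_pos_convex_span_of_mem_convexHull hx
      have hcard : Fintype.card ι < Module.finrank ℝ E + 2 :=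
        Nat.lt_succ_of_le (hind.card_le_finrank_succ.trans
          (Nat.succ_le_succ (Submodule.finrank_le _)))
      let e := (Fintype.equivFin ι).symm
      refine ⟨⟨Fintype.card ι, hcard⟩, w ∘ e, z ∘ e, ⟨⟨fun i => (hw _).le, ?_⟩, fun i _ =>
        hz ⟨_, rfl⟩⟩, ?_⟩
      · exact (e.sum_comp w).trans hw1
      · exact e.sum_comp fun i => w i • z i
    · rintro ⟨k, w, z, ⟨⟨hw, hw1⟩, hz⟩, rfl⟩
      exact (convex_convexHull ℝ S).sum_mem (fun i _ => hw i) hw1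
        fun i _ => subset_convexHull ℝ S (hz i trivial)
  rw [h]
  exact isCompact_iUnion fun k => ((isCompact_stdSimplex ℝ _).prod
    (isCompact_univ_pi fun _ => hS)).image (by fun_prop)

/-- If every k failed at some `w k`, compactness of K would leave finitely many such witnesses, and
Sion's finite lemma would merge them into one y that defeats all k at once. -/
theorem exists_forall_le_of_forall_exists_le {E F : Type*} [TopologicalSpace E] [AddCommGroup E]
    [Module ℝ E] [IsTopologicalAddGroup E] [ContinuousSMul ℝ E] [TopologicalSpace F]
    [AddCommGroup F] [Module ℝ F] [IsTopologicalAddGroup F] [ContinuousSMul ℝ F]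
    {K : Set E} (hKne : K.Nonempty) (hKc : IsCompact K) (hK : Convex ℝ K) {Y : Set F}
    (hY : Convex ℝ Y) {g : E → F → ℝ} (hg₁ : ∀ y ∈ Y, Continuous fun k => g k y)
    (hg₁' : ∀ y ∈ Y, ConvexOn ℝ K fun k => g k y) (hg₂ : ∀ k ∈ K, Continuous (g k))
    (hg₂' : ∀ k ∈ K, ConcaveOn ℝ Y (g k)) {r : ℝ} (h : ∀ y ∈ Y, ∃ k ∈ K, g k y ≤ r) :
    ∃ k ∈ K, ∀ y ∈ Y, g k y ≤ r := by
  by_contra! hcon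
  choose! w hwY hw using hcon
  obtain ⟨t, htK, ht⟩ := hKc.elim_nhds_subcover (fun k => {k' | r < g k' (w k)}) fun k hk =>
    (isOpen_lt continuous_const (hg₁ _ (hwY k hk))).mem_nhds (hw k hk)
  obtain ⟨y, hy, hlt⟩ := Sion.exists_lt_iInf_of_lt_iInf_of_finite (f := g) (t := r) hKne hKc
    (fun y hy => (hg₁ y hy).lowerSemicontinuous.lowerSemicontinuousOn _)
    (fun y hy => (hg₁' y hy).quasiconvexOn) hY
    (fun k hk => (hg₂ k hk).upperSemicontinuous.upperSemicontinuousOn _)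
    (fun k hk => (hg₂' k hk).quasiconcaveOn) hK (s := w '' t) (t.finite_toSet.image w)
    (by rintro _ ⟨k, hk, rfl⟩; exact hwY k (htK k hk))
    (fun k hk => by
      obtain ⟨k', hk', hkk'⟩ := Set.mem_iUnion₂.mp (ht hk)
      exact ⟨w k', ⟨k', hk', rfl⟩, hkk'⟩)
  obtain ⟨k, hk, hle⟩ := h y hy
  exact (hlt k hk).not_ge hle

/-! ### Quadratic forms on the unit sphere -/

variable {ℓ n m : ℕ}

theorem formP_smul (P : PolyMatrix m (Fin ℓ ⊕ Fin n)) (x : Fin n → ℝ) (a : ℝ) (v : Fin m → ℝ)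
    (y : Fin ℓ → ℝ) : formP P x (a • v) y = a ^ 2 * formP P x v y := by
  simp only [formP, Matrix.mulVec_smul, smul_dotProduct, dotProduct_smul, smul_eq_mul]
  ring

theorem formP_eq_norm_sq_mul (P : PolyMatrix m (Fin ℓ ⊕ Fin n)) (x : Fin n → ℝ) {v : Fin m → ℝ}
    (hv : v ≠ 0) (y : Fin ℓ → ℝ) :
    ‖‖v‖⁻¹ • v‖ = 1 ∧ formP P x v y = ‖v‖ ^ 2 * formP P x (‖v‖⁻¹ • v) y := by
  have h : ‖v‖ ≠ 0 := norm_ne_zero_iff.mpr hv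
  refine ⟨by rw [norm_smul, norm_inv, norm_norm, inv_mul_cancel₀ h], ?_⟩
  rw [← formP_smul, smul_inv_smul₀ h]

/-- The norm on `Fin m → ℝ` is the sup norm; homogeneity makes this harmless, and only compactness
of its sphere is needed later. -/
theorem posSemidef_evalP_of_sphere {P : PolyMatrix m (Fin ℓ ⊕ Fin n)} (hP : P.IsSymm)
    {y : Fin ℓ → ℝ} {x : Fin n → ℝ} (h : ∀ v : Fin m → ℝ, ‖v‖ = 1 → 0 ≤ formP P x v y) :
    (evalP P y x).PosSemidef := by
  refine .of_dotProduct_mulVec_nonneg (isSymm_evalP hP y x) fun v => ?_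
  change 0 ≤ formP P x v y
  rcases eq_or_ne v 0 with rfl | hv
  · simp [formP]
  · obtain ⟨h1, h2⟩ := formP_eq_norm_sq_mul P x hv y
    rw [h2]
    exact mul_nonneg (sq_nonneg _) (h _ h1)

theorem exists_pos_le_formP {P : PolyMatrix m (Fin ℓ ⊕ Fin n)} {𝒳 : Set (Fin n → ℝ)}
    (h𝒳 : IsCompact 𝒳) {y : Fin ℓ → ℝ} (hy : ∀ x ∈ 𝒳, (evalP P y x).PosDef) :
    ∃ σ > 0, ∀ x ∈ 𝒳, ∀ v : Fin m → ℝ, ‖v‖ = 1 → σ ≤ formP P x v y := by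
  rcases (𝒳 ×ˢ Metric.sphere (0 : Fin m → ℝ) 1).eq_empty_or_nonempty with he | hne
  -- The product is empty when 𝒳 is empty or m = 0, and any positive constant serves.
  · refine ⟨1, one_pos, fun x hx v hv => ?_⟩
    have h : (x, v) ∈ 𝒳 ×ˢ Metric.sphere (0 : Fin m → ℝ) 1 := ⟨hx, by simpa using hv⟩
    simp [he] at h
  · obtain ⟨⟨x₀, v₀⟩, ⟨hx₀, hv₀⟩, hmin⟩ := (h𝒳.prod (isCompact_sphere _ _)).exists_isMinOn hne
      (continuous_formP P y).continuousOn
    have hv0 : v₀ ≠ 0 := by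
      rintro rfl
      simp at hv₀
    refine ⟨formP P x₀ v₀ y, by simpa [formP] using (hy x₀ hx₀).dotProduct_mulVec_pos hv0,
      fun x hx v hv => ?_⟩
    exact hmin (show (x, v) ∈ _ from ⟨hx, by simpa using hv⟩)

/-- Exact penalization under the Slater condition. -/
theorem exists_penalty {f : MvPolynomial (Fin ℓ) ℝ} {P : PolyMatrix m (Fin ℓ ⊕ Fin n)}
    (hP : P.IsSymm) {Y : Set (Fin ℓ → ℝ)} (hY : Convex ℝ Y) {𝒳 : Set (Fin n → ℝ)}
    (h𝒳 : IsCompact 𝒳) (hf : ConvexOn ℝ Set.univ fun y => eval y f)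
    (hPc : ∀ x ∈ 𝒳, ∀ v, ConcaveOn ℝ Set.univ (formP P x v)) {z : Fin ℓ → ℝ} (hzY : z ∈ Y)
    (hz : ∀ x ∈ 𝒳, (evalP P z x).PosDef) {r : ℝ}
    (hr : ∀ y ∈ Y, (∀ x ∈ 𝒳, (evalP P y x).PosSemidef) → r ≤ eval y f) :
    ∃ R : ℝ, ∀ y ∈ Y, r ≤ eval y f ∨
      ∃ x ∈ 𝒳, ∃ v : Fin m → ℝ, ‖v‖ ≤ R ∧ r ≤ eval y f - formP P x v y := by
  obtain ⟨σ, hσ, hσle⟩ := exists_pos_le_formP h𝒳 hz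
  have hrz : r ≤ eval z f := hr z hzY fun x hx => (hz x hx).posSemidef
  have hR : 0 ≤ (eval z f - r) / σ := div_nonneg (sub_nonneg.mpr hrz) hσ.le
  -- The form is quadratic in v, so this radius gives the penalty weight (f(z) − r)/σ, which does
  -- not depend on y.
  refine ⟨√((eval z f - r) / σ), fun y hy => ?_⟩
  by_cases hfeas : ∀ x ∈ 𝒳, ∀ v : Fin m → ℝ, ‖v‖ = 1 → 0 ≤ formP P x v y
  · exact Or.inl (hr y hy fun x hx => posSemidef_evalP_of_sphere hP (hfeas x hx))
  right
  push Not at hfeas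
  obtain ⟨x₁, hx₁, v₁, hv₁, hneg⟩ := hfeas
  have h₁ : (x₁, v₁) ∈ 𝒳 ×ˢ Metric.sphere (0 : Fin m → ℝ) 1 := ⟨hx₁, by simpa using hv₁⟩
  obtain ⟨⟨x₀, v₀⟩, ⟨hx₀, hv₀⟩, hmin⟩ := (h𝒳.prod (isCompact_sphere _ _)).exists_isMinOn ⟨_, h₁⟩
    (continuous_formP P y).continuousOn
  have hv₀' : ‖v₀‖ = 1 := by simpa using hv₀
  obtain ⟨δ, hδ⟩ : ∃ δ, formP P x₀ v₀ y = -δ := ⟨-formP P x₀ v₀ y, by ring⟩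
  have hδpos : 0 < δ := by
    have h : formP P x₀ v₀ y ≤ formP P x₁ v₁ y := hmin h₁
    linarith
  refine ⟨x₀, hx₀, √((eval z f - r) / σ) • v₀, ?_, ?_⟩
  · rw [norm_smul, hv₀', mul_one, Real.norm_of_nonneg (Real.sqrt_nonneg _)]
  have hs : 0 < δ + σ := by positivity
  have ha : 0 ≤ σ / (δ + σ) := by positivity
  have hb : 0 ≤ δ / (δ + σ) := by positivity
  have hab : σ / (δ + σ) + δ / (δ + σ) = 1 := by field_simp; ring
  -- With −δ the worst value of the form at y and σ a lower bound at z, these weights balance the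
  -- violation against the slack exactly. By concavity the combination is feasible, so r bounds its
  -- objective; solving for r gives the penalized inequality.
  have hmid : r ≤ σ / (δ + σ) * eval y f + δ / (δ + σ) * eval z f := by
    refine (hr _ (hY hy hzY ha hb hab) fun x hx => posSemidef_evalP_of_sphere hP
      fun v hv => ?_).trans (hf.2 trivial trivial ha hb hab)
    have h1 := (hPc x hx v).2 (Set.mem_univ y) (Set.mem_univ z) ha hb hab
    have h2 : -δ ≤ formP P x v y :=
      hδ ▸ hmin (show (x, v) ∈ 𝒳 ×ˢ Metric.sphere (0 : Fin m → ℝ) 1 from ⟨hx, by simpa using hv⟩)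
    have h3 := hσle x hx v hv
    have h4 : σ / (δ + σ) * (-δ) + δ / (δ + σ) * σ = 0 := by ring
    simp only [smul_eq_mul] at h1
    linarith [mul_le_mul_of_nonneg_left h2 ha, mul_le_mul_of_nonneg_left h3 hb]
  rw [formP_smul, Real.sq_sqrt hR, hδ]
  have h5 : r * (δ + σ) ≤ σ * eval y f + δ * eval z f := by
    rw [← le_div_iff₀ hs]
    exact hmid.trans_eq (by ring)
  have h6 : r = (r * (δ + σ) - δ * r) / σ := by field_simp; ring
  calc r = (r * (δ + σ) - δ * r) / σ := h6
    _ ≤ (σ * eval y f + δ * eval z f - δ * r) / σ := by gcongr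
    _ = eval y f - (eval z f - r) / σ * -δ := by field_simp; ring

/-! ### Multipliers as points of a finite-dimensional convex set -/

/-- The vector `(ℒ(P_β))_β`. -/
def coeffVec (P : PolyMatrix m (Fin ℓ ⊕ Fin n)) (L : PolyMatrix m (Fin n) → ℝ) :
    supportY P → ℝ :=
  fun β => L (coeffY P β)

/-- The values at `y` of the monomials that occur in `P`. -/
def monomialVec (P : PolyMatrix m (Fin ℓ ⊕ Fin n)) (y : Fin ℓ → ℝ) : supportY P → ℝ :=
  fun β => eval y (monomial (β : Fin ℓ →₀ ℕ) (1 : ℝ))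

theorem coeffVec_dotProduct (P : PolyMatrix m (Fin ℓ ⊕ Fin n)) (L : PolyMatrix m (Fin n) → ℝ)
    (y : Fin ℓ → ℝ) : coeffVec P L ⬝ᵥ monomialVec P y = eval y (applyL L P) := by
  rw [eval_applyL, ← Finset.sum_coe_sort]
  rfl

theorem convex_range_coeffVec (P : PolyMatrix m (Fin ℓ ⊕ Fin n)) {𝒳 : Set (Fin n → ℝ)}
    (h𝒳 : IsCompact 𝒳) :
    Convex ℝ (Set.range fun Φ : PSDMatrixMeasure m 𝒳 => coeffVec P (momentL Φ)) := by
  rintro _ ⟨Φ, rfl⟩ _ ⟨Ψ, rfl⟩ a b ha hb _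
  exact ⟨Φ.combo Ψ ha hb, funext fun β => momentL_combo h𝒳 Φ Ψ ha hb _⟩

instance {𝒳 : Set (Fin n → ℝ)} : Zero (PSDMatrixMeasure m 𝒳) where
  zero := ⟨fun _ _ => 0, fun _ _ => rfl, fun _ _ => Matrix.PosSemidef.zero⟩

theorem momentL_zero {𝒳 : Set (Fin n → ℝ)} (F : PolyMatrix m (Fin n)) :
    momentL (0 : PSDMatrixMeasure m 𝒳) F = 0 :=
  Finset.sum_eq_zero fun _ _ => Finset.sum_eq_zero fun _ _ =>
    VectorMeasure.integral_zero_vectorMeasure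

/-- The linear functional `F ↦ vᵀ F(x) v`. -/
def pointForm (x : Fin n → ℝ) (v : Fin m → ℝ) (F : PolyMatrix m (Fin n)) : ℝ :=
  v ⬝ᵥ (evalMatrix F x).mulVec v

theorem coeffVec_pointForm_dotProduct (P : PolyMatrix m (Fin ℓ ⊕ Fin n)) (x : Fin n → ℝ)
    (v : Fin m → ℝ) (y : Fin ℓ → ℝ) :
    coeffVec P (pointForm x v) ⬝ᵥ monomialVec P y = formP P x v y := by
  rw [coeffVec_dotProduct, eval_applyL, formP_eq_sum]
  rfl

theorem continuous_pointForm (F : PolyMatrix m (Fin n)) :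
    Continuous fun z : (Fin n → ℝ) × (Fin m → ℝ) => pointForm z.1 z.2 F := by
  simp only [pointForm, dotProduct, Matrix.mulVec, evalMatrix, Matrix.map_apply]
  have h : ∀ i j, Continuous fun z : (Fin n → ℝ) × (Fin m → ℝ) => eval z.1 (F i j) :=
    fun i j => (MvPolynomial.continuous_eval (F i j)).comp continuous_fst
  fun_prop

/-- Existence of an optimal PSD matrix-valued Lagrange multiplier. -/
theorem exists_multiplier {f : MvPolynomial (Fin ℓ) ℝ} {P : PolyMatrix m (Fin ℓ ⊕ Fin n)}
    (hP : P.IsSymm) {Y : Set (Fin ℓ → ℝ)} (hY : Convex ℝ Y) {𝒳 : Set (Fin n → ℝ)}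
    (h𝒳 : IsCompact 𝒳) (hf : ConvexOn ℝ Set.univ fun y => eval y f)
    (hPc : ∀ x ∈ 𝒳, ∀ v, ConcaveOn ℝ Set.univ (formP P x v)) {z : Fin ℓ → ℝ} (hzY : z ∈ Y)
    (hz : ∀ x ∈ 𝒳, (evalP P z x).PosDef) {r : ℝ}
    (hr : ∀ y ∈ Y, (∀ x ∈ 𝒳, (evalP P y x).PosSemidef) → r ≤ eval y f) :
    ∃ Φ : PSDMatrixMeasure m 𝒳, f - C r - applyL (momentL Φ) P ∈ nonnegOn Y := by
  obtain ⟨R, hR⟩ := exists_penalty hP hY h𝒳 hf hPc hzY hz hr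
  let S : Set (supportY P → ℝ) :=
    (fun w : (Fin n → ℝ) × (Fin m → ℝ) => coeffVec P (pointForm w.1 w.2)) ''
      (𝒳 ×ˢ Metric.closedBall 0 R)
  have hSc : IsCompact S := (h𝒳.prod (isCompact_closedBall _ _)).image
    (continuous_pi fun β => continuous_pointForm _)
  -- The point 0 is the multiplier for those y with r ≤ f(y), and keeps K nonempty.
  let K := convexHull ℝ (insert 0 S)
  have h0K : (0 : supportY P → ℝ) ∈ K := subset_convexHull ℝ _ (Set.mem_insert _ _)
  have hconc : K ⊆ {k | ConcaveOn ℝ Set.univ fun y => k ⬝ᵥ monomialVec P y} := by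
    refine convexHull_min ?_ ?_
    · rintro k (rfl | ⟨⟨x, v⟩, ⟨hx, -⟩, rfl⟩)
      · simpa using concaveOn_const (0 : ℝ) convex_univ
      · simpa only [Set.mem_ofPred_eq, coeffVec_pointForm_dotProduct] using hPc x hx v
    · intro k hk l hl a b ha hb _
      simp only [Set.mem_ofPred_eq, add_dotProduct, smul_dotProduct]
      exact (hk.smul ha).add (hl.smul hb)
  have hrange : K ⊆ Set.range fun Φ : PSDMatrixMeasure m 𝒳 => coeffVec P (momentL Φ) := by
    refine convexHull_min ?_ (convex_range_coeffVec P h𝒳)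
    rintro k (rfl | ⟨⟨x, v⟩, ⟨hx, -⟩, rfl⟩)
    · exact ⟨0, funext fun β => momentL_zero _⟩
    · exact ⟨PSDMatrixMeasure.dirac ⟨x, hx⟩ v, funext fun β => momentL_dirac _ _ _⟩
  have hcont : Continuous fun y : Fin ℓ → ℝ => eval y f := MvPolynomial.continuous_eval f
  have hcontm : ∀ β : supportY P, Continuous fun y : Fin ℓ → ℝ => monomialVec P y β :=
    fun β => MvPolynomial.continuous_eval _
  -- The payoff k·(y^β)_β − f(y) is affine in k and concave in y, and penalization supplies a k with
  -- payoff at most −r for each y.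
  obtain ⟨k, hk, hky⟩ := exists_forall_le_of_forall_exists_le (K := K) (Y := Y) (r := -r)
    (g := fun k y => k ⬝ᵥ monomialVec P y - eval y f) ⟨0, h0K⟩
    ((hSc.insert 0).convexHull_of_finiteDimensional) (convex_convexHull ℝ _) hY
    (fun y _ => by simp only [dotProduct]; fun_prop)
    (fun y _ => ⟨convex_convexHull ℝ _, fun k _ l _ a b _ _ hab => by
      simp only [add_dotProduct, smul_dotProduct, smul_eq_mul]
      linear_combination eval y f * hab⟩)
    (fun k _ => by simp only [dotProduct]; fun_prop)
    (fun k hk => ((hconc hk).sub hf).subset (Set.subset_univ _) hY)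
    (fun y hy => by
      rcases hR y hy with h | ⟨x, hx, v, hv, h⟩
      · exact ⟨0, h0K, by simpa using h⟩
      · refine ⟨_, subset_convexHull ℝ _ (Set.mem_insert_of_mem _
          ⟨(x, v), ⟨hx, by simpa using hv⟩, rfl⟩), ?_⟩
        simp only [coeffVec_pointForm_dotProduct]
        linarith)
  obtain ⟨Φ, rfl⟩ := hrange hk
  refine ⟨Φ, fun y hy => ?_⟩
  have h := hky y hy
  simp only [coeffVec_dotProduct] at h
  simp only [map_sub, eval_C]
  linarith

/-! ### Weak duality -/

/-- The interchange of the two integrations needs no Fubini theorem: P is a finite sum over β of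
products separating x from y. -/
theorem momentH_applyL {P : PolyMatrix m (Fin ℓ ⊕ Fin n)} {𝒳 : Set (Fin n → ℝ)}
    (h𝒳 : IsCompact 𝒳) {Y : Set (Fin ℓ → ℝ)} (Φ : PSDMatrixMeasure m 𝒳) {μ : Measure Y}
    (hμ : ∀ h : MvPolynomial (Fin ℓ) ℝ, Integrable (fun y : Y => eval (y : Fin ℓ → ℝ) h) μ) :
    momentH μ (applyL (momentL Φ) P) = momentL Φ (applyH (momentH μ) P) := by
  rw [applyH, momentL_sum_smul h𝒳]
  simp_rw [momentH, eval_applyL]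
  rw [integral_finsetSum _ fun β _ => (hμ _).const_mul _]
  exact Finset.sum_congr rfl fun β _ => by rw [integral_const_mul, mul_comm]

theorem conicVal_le_dualVal (f : MvPolynomial (Fin ℓ) ℝ) (P : PolyMatrix m (Fin ℓ ⊕ Fin n))
    (Y : Set (Fin ℓ → ℝ)) {𝒳 : Set (Fin n → ℝ)} (h𝒳 : IsCompact 𝒳) :
    conicVal f P Y 𝒳 ≤ dualVal f P Y 𝒳 := by
  refine sSup_le ?_
  rintro _ ⟨ρ, Φ, hΦ, rfl⟩
  refine le_sInf ?_
  rintro _ ⟨μ, _, hμ, hμ1, hμP, rfl⟩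
  have h1 : 0 ≤ ∫ y : Y, eval (y : Fin ℓ → ℝ) (f - C ρ - applyL (momentL Φ) P) ∂μ :=
    integral_nonneg fun y => hΦ y y.2
  have hone : ∫ _ : Y, (1 : ℝ) ∂μ = 1 := by simpa [momentH] using hμ1
  have h2 : ∫ y : Y, eval (y : Fin ℓ → ℝ) (f - C ρ - applyL (momentL Φ) P) ∂μ =
      momentH μ f - ρ - momentH μ (applyL (momentL Φ) P) := by
    simp only [map_sub]
    rw [integral_sub (by exact (hμ f).sub (hμ (C ρ))) (hμ _), integral_sub (hμ f) (hμ (C ρ))]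
    have hρ : ∫ y : Y, eval (y : Fin ℓ → ℝ) (C ρ) ∂μ = ρ := by
      have : (fun y : Y => eval (y : Fin ℓ → ℝ) (C ρ)) = fun _ => ρ * 1 := by
        funext y
        simp
      rw [this, integral_const_mul, hone, mul_one]
    rw [hρ]
    rfl
  have h3 := momentL_nonneg h𝒳 Φ hμP.2
  rw [h2, momentH_applyL h𝒳 Φ hμ] at h1
  exact EReal.coe_le_coe_iff.mpr (by linarith)

theorem momentH_dirac {Y : Set (Fin ℓ → ℝ)} (y : Y) (h : MvPolynomial (Fin ℓ) ℝ) :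
    momentH (Measure.dirac y) h = eval (y : Fin ℓ → ℝ) h :=
  integral_dirac _ _

theorem dualVal_le_optVal (f : MvPolynomial (Fin ℓ) ℝ) {P : PolyMatrix m (Fin ℓ ⊕ Fin n)}
    (hP : P.IsSymm) (Y : Set (Fin ℓ → ℝ)) (𝒳 : Set (Fin n → ℝ)) :
    dualVal f P Y 𝒳 ≤ optVal f P Y 𝒳 := by
  refine le_sInf ?_
  rintro _ ⟨y, hy, hyP, rfl⟩
  refine sInf_le ⟨Measure.dirac ⟨y, hy⟩, inferInstance, fun h => integrable_dirac (by simp), ?_,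
    ⟨isSymm_applyH _ hP, fun x hx => ?_⟩, ?_⟩
  · rw [momentH_dirac, map_one]
  · rw [evalMatrix_applyH]
    simp_rw [momentH_dirac]
    rw [← evalP_eq_sum]
    exact hyP x hx
  · rw [momentH_dirac]

end RobustPMI
end

theorem mainTheorem4 {ℓ n m q s : ℕ}
    (f : MvPolynomial (Fin ℓ) ℝ) (θ : Fin s → MvPolynomial (Fin ℓ) ℝ)
    (G : RobustPMI.PolyMatrix q (Fin n)) (hG : G.IsSymm)
    (P : RobustPMI.PolyMatrix m (Fin ℓ ⊕ Fin n)) (hP : P.IsSymm)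
    (hf : RobustPMI.SOSConvex f) (hθ : ∀ i, RobustPMI.SOSConvex (-θ i))
    (hPconv : ∀ x ∈ RobustPMI.uncertaintySet G, RobustPMI.PSDSOSConvex (-RobustPMI.specialize P x))
    (hcompact : IsCompact (RobustPMI.uncertaintySet G))
    (hSlater : RobustPMI.Slater θ P (RobustPMI.uncertaintySet G)) :
    RobustPMI.conicVal f P (RobustPMI.decisionSet θ) (RobustPMI.uncertaintySet G) =
        RobustPMI.dualVal f P (RobustPMI.decisionSet θ) (RobustPMI.uncertaintySet G) ∧
      RobustPMI.dualVal f P (RobustPMI.decisionSet θ) (RobustPMI.uncertaintySet G) =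
        RobustPMI.optVal f P (RobustPMI.decisionSet θ) (RobustPMI.uncertaintySet G) := by
  open RobustPMI in
  have h1 := conicVal_le_dualVal f P (decisionSet θ) hcompact
  have h2 := dualVal_le_optVal f hP (decisionSet θ) (uncertaintySet G)
  have h3 : optVal f P (decisionSet θ) (uncertaintySet G) ≤
      conicVal f P (decisionSet θ) (uncertaintySet G) := by
    obtain ⟨z, hzθ, hz⟩ := hSlater
    have hzY : z ∈ decisionSet θ := fun i => (hzθ i).le
    have hle : ∀ y ∈ decisionSet θ, (∀ x ∈ uncertaintySet G, (evalP P y x).PosSemidef) →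
        optVal f P (decisionSet θ) (uncertaintySet G) ≤ ((eval y f : ℝ) : EReal) :=
      fun y hy hyP => sInf_le ⟨y, hy, hyP, rfl⟩
    -- The value −∞ is trivial and +∞ is excluded by the feasible Slater point; a finite value r is
    -- itself attained as a certificate.
    induction h : optVal f P (decisionSet θ) (uncertaintySet G) using EReal.rec with
    | bot => exact bot_le
    | top =>
      have := hle z hzY fun x hx => (hz x hx).posSemidef
      simp [h] at this
    | coe r =>
      obtain ⟨Φ, hΦ⟩ := exists_multiplier hP (convex_decisionSet hθ) hcompact hf.convexOn
        (fun x hx v => concaveOn_formP (hPconv x hx) v) hzY hz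
        (fun y hy hyP => EReal.coe_le_coe_iff.mp (h ▸ hle y hy hyP))
      exact le_sSup ⟨r, Φ, hΦ, rfl⟩
  exact ⟨le_antisymm h1 (h2.trans h3), le_antisymm h2 (h3.trans h1)⟩
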